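/- \textbf{Setting.} Let $\mathcal U=[-1,1]^{\mathbb N}$ with the product topology and the uniform probability measure $\varrho$ (the infinite product of the normalized Lebesgue measure on $[-1,1]$). For $\rho\ge 1$ let $\mathcal E(\rho)=\{(z+z^{-1})/2: z\in\mathbb C,\ 1\le|z|\le\rho\}$, and for $\bm\rho=(\rho_j)_{j\in\mathbb N}\ge\bm 1$ let $\mathcal E(\bm\rho)=\mathcal E(\rho_1)\times\mathcal E(\rho_2)\times\cdots\subset\mathbb C^{\mathbb N}$. For $\bm b\in[0,\infty)^{\mathbb N}$ put $$\mathcal R(\bm b)=\bigcup\Big\{\mathcal E(\bm\rho):\bm\rho\ge\bm 1,\ \sum_{j=1}^\infty\Big(\tfrac{\rho_j+\rho_j^{-1}}2-1\Big)b_j\le 1\Big\}.$$ Let $\mathcal H(\bm b)$ be the set of continuous $f:\mathcal U\to\mathbb R$ that have an extension $\tilde f:\mathcal O\to\mathbb C$ to an open neighbourhood $\mathcal O\subseteq\mathbb C^{\mathbb N}$ (product topology) of $\mathcal R(\bm b)$ which is holomorphic, i.e. complex differentiable in each variable at each point of $\mathcal O$, and satisfies $\sup_{\bm z\in\mathcal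 R(\bm b)}|\tilde f(\bm z)|\le 1$. For $0<p<1$ let $\|\bm b\|_p=(\sum_j|b_j|^p)^{1/p}$ and $\|\bm b\|_{p,\mathsf M}=\|\tilde{\bm b}\|_p$, where $\tilde b_i=\sup_{j\ge i}|b_j|$, and let $$B_p=\{\bm b\in[0,\infty)^{\mathbb N}:\|\bm b\|_p\le1\},\qquad B_{p,\mathsf M}=\{\bm b\in[0,\infty)^{\mathbb N}:\|\bm b\|_{p,\mathsf M}\le 1\},$$ $$\mathcal H(p)=\bigcup_{\bm b\in B_p}\mathcal H(\bm b),\qquad \mathcal H(p,\mathsf M)=\bigcup_{\bm b\in B_{p,\mathsf M}}\mathcal H(\bm b).$$ An adaptive sampling operator is a map $\mathcal S:C(\mathcal U)\to\mathbb R^m$ of the form $\mathcal S(f)_i=S_i(f;\mathcal S(f)_1,\dots,\mathcal S(f)_{i-1})$, $i=1,\dots,m$, where $S_i:C(\mathcal U)\times\mathbb R^{i-1}\to\mathbb R$ is a bounded linear functional of its first argument for every value of the second. The adaptive $m$-width of $\mathcal K\subseteq C(\mathcal U)$ is $$\Theta_m(\mathcal K)=\inf_{\mathcal S,\mathcal R}\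 \sup_{f\in\mathcal K}\|f-\mathcal R(\mathcal S(f))\|_{L^2_\varrho(\mathcal U)},$$ with the infimum over all adaptive sampling operators $\mathcal S:C(\mathcal U)\to\mathbb R^m$ and all maps $\mathcal R:\mathbb R^m\to C(\mathcal U)$. Put $$\theta_m(p)=\Theta_m(\mathcal H(p)),\qquad \theta_m(p,\mathsf M)=\Theta_m(\mathcal H(p,\mathsf M)),$$ $$\overline{\theta_m}(p)=\sup_{\bm b\in B_p}\Theta_m(\mathcal H(\bm b)),\qquad \overline{\theta_m}(p,\mathsf M)=\sup_{\bm b\in B_{p,\mathsf M}}\Theta_m(\mathcal H(\bm b)).$$ \textbf{Theorem (Limits of learnability).} There is a universal constant $c>0$ such that, for all integers $m\ge1$ and all $0<p<1$: \begin{itemize} \item $\overline{\theta_m}(p)\ \ge\ \overline{\theta_m}(p,\mathsf M)\ \ge\ c\cdot 2^{-1/p}\, m^{1/2-1/p}$; \item $\theta_m(p)\ \ge\ c\cdot 2^{1/2-2/p}$; \item $\theta_m(p,\mathsf M)\ \ge\ \overline{\theta_m}(p,\mathsf M)\ \ge\ c\cdot 2^{-1/p}\, m^{1/2-1/p}$.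 \end{itemize} -/

import Mathlib

open MeasureTheory Filter Topology
open scoped ENNReal

noncomputable section

namespace HolWidth

/-! ### The domain and its uniform probability measure -/

/-- The parameter domain `[-1,1]^ℕ` with the product topology (a compact Hausdorff space). -/
abbrev U : Type := ℕ → Set.Icc (-1 : ℝ) 1

/-- The uniform probability measure on `[-1,1]`: half of the Lebesgue measure. -/
def unif : Measure (Set.Icc (-1 : ℝ) 1) :=
  (2 : ℝ≥0∞)⁻¹ • Measure.comap (Subtype.val : Set.Icc (-1 : ℝ) 1 → ℝ) volume

instance : IsProbabilityMeasure unif := ⟨by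
  have h : Measure.comap (Subtype.val : Set.Icc (-1 : ℝ) 1 → ℝ) volume Set.univ = 2 := by
    rw [comap_subtype_coe_apply measurableSet_Icc, Set.image_univ, Subtype.range_coe,
      Real.volume_Icc]
    norm_num
  rw [unif, Measure.smul_apply, h, smul_eq_mul]
  exact ENNReal.inv_mul_cancel (by norm_num) (by norm_num)⟩

/-- The uniform probability measure on `[-1,1]^ℕ`: the infinite product of `unif`. -/
def rho : Measure U := Measure.infinitePi (fun _ : ℕ => unif)

/-- The inclusion of `[-1,1]^ℕ` in `ℂ^ℕ`. -/
def toComplex (y : U) : ℕ → ℂ := fun j => ((y j : ℝ) : ℂ)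

/-! ### Holomorphic functions of infinitely many variables -/

/-- `F` is holomorphic in the open set `O ⊆ ℂ^ℕ`: it has a complex derivative with respect to
each variable at each point of `O`. Values of `F` outside `O` are irrelevant, since `O` is open. -/
def HolomorphicIn (F : (ℕ → ℂ) → ℂ) (O : Set (ℕ → ℂ)) : Prop :=
  IsOpen O ∧ ∀ z ∈ O, ∀ j : ℕ, DifferentiableAt ℂ (fun h : ℂ => F (z + Pi.single j h)) 0

/-- The (filled) Bernstein ellipse with parameter `ρ ≥ 1`; it is `[-1,1]` for `ρ = 1`. -/
def bernsteinEllipse (ρ : ℝ) : Set ℂ :=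
  {w | ∃ z : ℂ, 1 ≤ ‖z‖ ∧ ‖z‖ ≤ ρ ∧ w = (z + z⁻¹) / 2}

/-- The Bernstein polyellipse, a product of Bernstein ellipses. -/
def bernsteinPolyellipse (ρ : ℕ → ℝ) : Set (ℕ → ℂ) :=
  {w | ∀ j, w j ∈ bernsteinEllipse (ρ j)}

/-- The region `R(b,ε)`: the union of all Bernstein polyellipses with parameter `ρ ≥ 1` such that
`∑ j, ((ρ j + (ρ j)⁻¹) / 2 - 1) * b j` converges and is at most `ε`. -/
def region (b : ℕ → ℝ) (ε : ℝ) : Set (ℕ → ℂ) :=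
  {w | ∃ ρ : ℕ → ℝ, (∀ j, 1 ≤ ρ j) ∧
    Summable (fun j => ((ρ j + (ρ j)⁻¹) / 2 - 1) * b j) ∧
    ∑' j, ((ρ j + (ρ j)⁻¹) / 2 - 1) * b j ≤ ε ∧
    w ∈ bernsteinPolyellipse ρ}

/-- `F` is a holomorphic extension of the real function `f` on `[-1,1]^ℕ` to the (closed) set
`R`: it is holomorphic in some open neighbourhood of `R` and agrees with `f` on `[-1,1]^ℕ`. -/
def IsHolomorphicExtension (f : U → ℝ) (R : Set (ℕ → ℂ)) (F : (ℕ → ℂ) → ℂ) : Prop :=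
  (∃ O : Set (ℕ → ℂ), R ⊆ O ∧ HolomorphicIn F O) ∧ ∀ y : U, F (toComplex y) = (f y : ℂ)

/-- The class `H(b)` of (continuous, real-valued) `(b,1)`-holomorphic functions of norm at most
one on `R(b,1)`. -/
def H (b : ℕ → ℝ) : Set C(U, ℝ) :=
  {f | ∃ F : (ℕ → ℂ) → ℂ, IsHolomorphicExtension f (region b 1) F ∧
    ∀ z ∈ region b 1, ‖F z‖ ≤ 1}

/-! ### Sequence spaces and the classes `H(p)`, `H(p,M)` -/

/-- The `ℓ^p` (quasi-)norm of a real sequence, for `0 < p < ∞` and sequences in `ℓ^p`. -/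
def lpNorm (p : ℝ) (b : ℕ → ℝ) : ℝ := (∑' j, |b j| ^ p) ^ (1 / p)

/-- The minimal monotone majorant of a bounded sequence. -/
def majorant (b : ℕ → ℝ) : ℕ → ℝ := fun i => ⨆ j : {j : ℕ // i ≤ j}, |b j|

/-- The nonnegative sequences `b ∈ ℓ^p` with `‖b‖_p ≤ 1`. -/
def unitBall (p : ℝ) : Set (ℕ → ℝ) :=
  {b | (∀ j, 0 ≤ b j) ∧ Memℓp b (ENNReal.ofReal p) ∧ lpNorm p b ≤ 1}

/-- The nonnegative sequences `b` in the monotone `ℓ^p`-space with `‖b‖_{p,M} ≤ 1`. -/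
def unitBallM (p : ℝ) : Set (ℕ → ℝ) :=
  {b | (∀ j, 0 ≤ b j) ∧ Memℓp b ∞ ∧ Memℓp (majorant b) (ENNReal.ofReal p) ∧
    lpNorm p (majorant b) ≤ 1}

/-- The class `H(p)`. -/
def Hp (p : ℝ) : Set C(U, ℝ) := ⋃ b ∈ unitBall p, H b

/-- The class `H(p,M)`. -/
def HpM (p : ℝ) : Set C(U, ℝ) := ⋃ b ∈ unitBallM p, H b

/-! ### Adaptive widths -/

/-- `T : C(U) → ℝ^m` is an adaptive sampling operator: its `i`-th entry is `S i y f`, where `y` is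
the vector of the previous entries and `S i y` is, for every `y`, a bounded linear functional. -/
def IsAdaptiveSampling (m : ℕ) (T : C(U, ℝ) → (Fin m → ℝ)) : Prop :=
  ∃ S : (i : Fin m) → (Fin i.val → ℝ) → (C(U, ℝ) →L[ℝ] ℝ),
    ∀ (f : C(U, ℝ)) (i : Fin m),
      T f i = S i (fun j : Fin i.val => T f (Fin.castLE i.isLt.le j)) f

/-- The adaptive `m`-width of `K ⊆ C(U)`, with values in `[0,∞]`: the infimum over all adaptive
sampling operators `T` and all maps `R : ℝ^m → C(U)` of the worst-case `L²` error over `K`. -/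
def width (m : ℕ) (K : Set C(U, ℝ)) : ℝ≥0∞ :=
  ⨅ (T : C(U, ℝ) → (Fin m → ℝ)) (_ : IsAdaptiveSampling m T) (R : (Fin m → ℝ) → C(U, ℝ)),
    ⨆ f ∈ K, eLpNorm (fun y : U => f y - R (T f) y) 2 rho

/-- The width `θ_m(p)`, unknown anisotropy. -/
def theta (m : ℕ) (p : ℝ) : ℝ≥0∞ := width m (Hp p)

/-- The width `θ_m(p,M)`, unknown anisotropy. -/
def thetaM (m : ℕ) (p : ℝ) : ℝ≥0∞ := width m (HpM p)

/-- The width `\overline{θ_m}(p)`, known anisotropy. -/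
def thetaBar (m : ℕ) (p : ℝ) : ℝ≥0∞ := ⨆ b ∈ unitBall p, width m (H b)

/-- The width `\overline{θ_m}(p,M)`, known anisotropy. -/
def thetaBarM (m : ℕ) (p : ℝ) : ℝ≥0∞ := ⨆ b ∈ unitBallM p, width m (H b)

end HolWidth

end

/-!
The linear functions `∑ c k • y k` with `|c k| ≤ b k / 2` and `∑ b k ≤ 1` belong to `H b`, and
their `L²` norms are at least `√(∑ c k ^ 2 / 3)`. An adaptive scheme cannot tell `f` from `-f` when
both have zero samples, and its first run of zero answers uses only `m` fixed functionals. So a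
width is bounded below by the norm of any linear function of the (symmetric) class on which `m`
given functionals vanish, that is, by any linear relation `∑ c k • a k = 0` between the sample
vectors `a k ∈ ℝᵐ` of the coordinates.

* If `b` is constant on `2 m` indices, the relations between the corresponding `a k` form a space of
  dimension at least `m`. An extreme point of its intersection with the unit cube has at least `m`
  coordinates equal to `±1`.
* If `b` is only known to lie in the `ℓᵖ` ball, all of the infinitely many bounded vectors `a k` may
  be used. Two of them are almost equal, and their small difference is a combination with small
  coefficients of finitely many fixed `a k`; the bound obtained does not decay in `m`.
-/

namespace HolWidth

open ProbabilityTheory Module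

/-! ### Linear relations in finite-dimensional spaces -/

section LinearRelations

lemma exists_pos_forall_abs_add_mul_abs_le_one {ι : Type*} [Finite ι] {x v : ι → ℝ}
    (hx : ∀ i, |x i| ≤ 1) (hv : ∀ i, |x i| = 1 → v i = 0) :
    ∃ t > 0, ∀ i, |x i| + t * |v i| ≤ 1 := by
  have hev : ∀ᶠ t : ℝ in 𝓝[>] 0, ∀ i, |x i| + t * |v i| ≤ 1 := by
    refine eventually_all.mpr fun i => ?_
    rcases (hx i).eq_or_lt with heq | hlt
    · simp [hv i heq, heq]
    · have hcont : Continuous fun t : ℝ => |x i| + t * |v i| := by fun_prop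
      exact nhdsWithin_le_nhds
        ((hcont.tendsto' 0 _ (by simp)).eventually_lt_const hlt |>.mono fun _ => le_of_lt)
  exact (eventually_mem_nhdsWithin.and hev).exists

lemma finrank_le_card_of_mem_extremePoints {ι : Type*} [Fintype ι] {V : Submodule ℝ (ι → ℝ)}
    {x : ι → ℝ} (hx : x ∈ (Metric.closedBall 0 1 ∩ (V : Set (ι → ℝ))).extremePoints ℝ) :
    finrank ℝ V ≤ Finset.card {i | |x i| = 1} := by
  classical
  obtain ⟨⟨hx1, hxV⟩, hext⟩ := mem_extremePoints_iff_left.mp hx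
  have hball : ∀ y : ι → ℝ, y ∈ Metric.closedBall 0 1 ↔ ∀ i, |y i| ≤ 1 := fun y => by
    simp [pi_norm_le_iff_of_nonneg]
  by_contra! hlt
  let restrict := (LinearMap.funLeft ℝ ℝ (Subtype.val : {i // |x i| = 1} → ι)).domRestrict V
  have hker : LinearMap.ker restrict ≠ ⊥ :=
    LinearMap.ker_ne_bot_of_finrank_lt (by simpa [Fintype.card_subtype] using hlt)
  obtain ⟨v, hv, hv0⟩ := Submodule.exists_mem_ne_zero_of_ne_bot hker
  have hv_tight : ∀ i, |x i| = 1 → (v : ι → ℝ) i = 0 := fun i hi => congrFun hv ⟨i, hi⟩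
  obtain ⟨t, ht, hle⟩ := exists_pos_forall_abs_add_mul_abs_le_one ((hball x).mp hx1) hv_tight
  have hmem : ∀ r : ℝ, |r| = t → x + r • (v : ι → ℝ) ∈ Metric.closedBall 0 1 ∩ (V : Set (ι → ℝ)) :=
    fun r hr => ⟨(hball _).mpr fun i => (abs_add_le _ _).trans (by simpa [abs_mul, hr] using hle i),
      V.add_mem hxV (V.smul_mem r v.2)⟩
  have hminus := hmem (-t) (by rw [abs_neg, abs_of_pos ht])
  rw [neg_smul, ← sub_eq_add_neg] at hminus
  have heq := hext _ hminus _ (hmem t (abs_of_pos ht)) (mem_openSegment_sub_add _ _)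
  have htv : t • (v : ι → ℝ) = 0 := sub_eq_self.mp heq
  exact hv0 (Subtype.ext ((smul_eq_zero_iff_right ht.ne').mp htv))

lemma exists_mem_forall_abs_le_one_finrank_le_sum_sq {ι : Type*} [Fintype ι]
    (V : Submodule ℝ (ι → ℝ)) :
    ∃ x ∈ V, (∀ i, |x i| ≤ 1) ∧ (finrank ℝ V : ℝ) ≤ ∑ i, x i ^ 2 := by
  have hcompact : IsCompact (Metric.closedBall 0 1 ∩ (V : Set (ι → ℝ))) :=
    (isCompact_closedBall _ _).inter_right V.closed_of_finiteDimensional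
  obtain ⟨x, hx⟩ := hcompact.extremePoints_nonempty ⟨0, by simp⟩
  obtain ⟨hx1, hxV⟩ := extremePoints_subset hx
  refine ⟨x, hxV, by simpa [pi_norm_le_iff_of_nonneg] using hx1, ?_⟩
  calc (finrank ℝ V : ℝ) ≤ Finset.card {i | |x i| = 1} :=
        mod_cast finrank_le_card_of_mem_extremePoints hx
    _ = ∑ i with |x i| = 1, x i ^ 2 := by
        rw [Finset.sum_congr rfl fun i hi => by rw [← sq_abs, (Finset.mem_filter.mp hi).2],
          Finset.sum_const]
        simp
    _ ≤ ∑ i, x i ^ 2 :=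
        Finset.sum_le_univ_sum_of_nonneg fun i => sq_nonneg _

lemma exists_sum_smul_eq_zero_card_sub_finrank_le {ι E : Type*} [AddCommGroup E] [Module ℝ E]
    [FiniteDimensional ℝ E] (a : ι → E) (s : Finset ι) :
    ∃ x : ι → ℝ, ∑ k ∈ s, x k • a k = 0 ∧ (∀ k ∈ s, |x k| ≤ 1) ∧
      (s.card : ℝ) - finrank ℝ E ≤ ∑ k ∈ s, x k ^ 2 := by
  set A : (s → ℝ) →ₗ[ℝ] E := Fintype.linearCombination ℝ fun k : s => a k
  obtain ⟨y, hyA, hy1, hy2⟩ := exists_mem_forall_abs_le_one_finrank_le_sum_sq (LinearMap.ker A)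
  obtain ⟨x, rfl⟩ := Subtype.val_injective.surjective_comp_right y
  refine ⟨x, ?_, fun k hk => hy1 ⟨k, hk⟩, ?_⟩
  · rw [← Finset.sum_coe_sort]
    simpa [A, Fintype.linearCombination_apply] using hyA
  · have hrank : s.card ≤ finrank ℝ E + finrank ℝ (LinearMap.ker A) := by
      have h := A.finrank_range_add_finrank_ker
      rw [finrank_fintype_fun_eq_card, Fintype.card_coe] at h
      exact h ▸ Nat.add_le_add_right (Submodule.finrank_le _) _
    rw [← Finset.sum_coe_sort s fun k => x k ^ 2]
    refine le_trans ?_ hy2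
    rw [sub_le_iff_le_add']
    exact_mod_cast hrank

lemma exists_lt_dist_lt_of_isBounded_range {X : Type*} [PseudoMetricSpace X] [ProperSpace X]
    {a : ℕ → X} (ha : Bornology.IsBounded (Set.range a)) (n : ℕ) {ε : ℝ} (hε : 0 < ε) :
    ∃ i j, n ≤ i ∧ i < j ∧ dist (a j) (a i) < ε := by
  obtain ⟨_, -, φ, hφ, hlim⟩ := tendsto_subseq_of_bounded ha Set.mem_range_self
  obtain ⟨N, hN⟩ := Metric.cauchySeq_iff.mp hlim.cauchySeq ε hε
  set M := max N n
  exact ⟨φ M, φ (M + 1), (le_max_right N n).trans (hφ.id_le M), hφ M.lt_succ_self,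
    hN _ ((le_max_left N n).trans M.le_succ) _ (le_max_left N n)⟩

variable {E : Type*} [NormedAddCommGroup E] [NormedSpace ℝ E] [FiniteDimensional ℝ E]

lemma exists_finset_forall_mem_span_range_exists_sum_smul_eq {ι : Type*} (a : ι → E) :
    ∃ (J : Finset ι) (C : ℝ), 0 < C ∧ ∀ v ∈ Submodule.span ℝ (Set.range a),
      ∃ t : ι → ℝ, ∑ k ∈ J, t k • a k = v ∧ ∀ k ∈ J, |t k| ≤ C * ‖v‖ := by
  classical
  obtain ⟨S, hS, hspan⟩ := (Submodule.fg_span_iff_fg_span_finset_subset (R := ℝ)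
    (Set.range a)).mp (IsNoetherian.noetherian _)
  obtain ⟨J, -, rfl⟩ := Finset.subset_set_image_iff.mp (Set.image_univ ▸ hS)
  set G : (J → ℝ) →ₗ[ℝ] E := Fintype.linearCombination ℝ fun k : J => a k
  have hG : LinearMap.range G = Submodule.span ℝ (Set.range a) := by
    rw [Fintype.range_linearCombination, hspan, Finset.coe_image, Set.image_eq_range]
    rfl
  have : CompleteSpace (LinearMap.range G) := FiniteDimensional.complete ℝ _
  obtain ⟨C, hC, hpre⟩ := G.rangeRestrict.toContinuousLinearMap.exists_preimage_norm_le
    G.surjective_rangeRestrict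
  refine ⟨J, C, hC, fun v hv => ?_⟩
  obtain ⟨y, hyv, hyC⟩ := hpre ⟨v, hG ▸ hv⟩
  obtain ⟨t, rfl⟩ := Subtype.val_injective.surjective_comp_right y
  refine ⟨t, ?_, fun k hk => (norm_le_pi_norm (t ∘ Subtype.val) ⟨k, hk⟩).trans hyC⟩
  rw [← Finset.sum_coe_sort]
  exact congrArg Subtype.val hyv

lemma exists_pos_mul_rpow_le {p η : ℝ} (hp : 0 < p) (hη : 0 < η) (n : ℕ) :
    ∃ δ > 0, n * δ ^ p ≤ η := by
  refine ⟨(η / (n + 1)) ^ p⁻¹, by positivity, ?_⟩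
  rw [Real.rpow_inv_rpow (by positivity) hp.ne', mul_div_assoc', div_le_iff₀ (by positivity)]
  linarith

lemma exists_sub_eq_sum_smul_sum_rpow_le {a : ℕ → E} (ha : Bornology.IsBounded (Set.range a))
    {p η : ℝ} (hp : 0 < p) (hη : 0 < η) :
    ∃ (J : Finset ℕ) (i j : ℕ) (t : ℕ → ℝ), i ∉ J ∧ j ∉ J ∧ i ≠ j ∧
      ∑ k ∈ J, t k • a k = a j - a i ∧ ∑ k ∈ J, |t k| ^ p ≤ η := by
  obtain ⟨J, C, hC, hJ⟩ := exists_finset_forall_mem_span_range_exists_sum_smul_eq a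
  obtain ⟨δ, hδ, hδη⟩ := exists_pos_mul_rpow_le hp hη J.card
  obtain ⟨i, j, hi, hij, hdist⟩ :=
    exists_lt_dist_lt_of_isBounded_range ha (J.sup id + 1) (div_pos hδ hC)
  obtain ⟨t, hsum, ht⟩ := hJ (a j - a i)
    (sub_mem (Submodule.subset_span ⟨j, rfl⟩) (Submodule.subset_span ⟨i, rfl⟩))
  have hnotMem : ∀ k, J.sup id < k → k ∉ J := fun k hk hkJ =>
    hk.not_ge (Finset.le_sup (f := id) hkJ)
  have htδ : ∀ k ∈ J, |t k| ≤ δ := fun k hk => by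
    rw [dist_eq_norm, lt_div_iff₀' hC] at hdist
    exact (ht k hk).trans hdist.le
  refine ⟨J, i, j, t, hnotMem i hi, hnotMem j (Nat.lt_of_succ_le hi |>.trans hij), hij.ne, hsum, ?_⟩
  calc ∑ k ∈ J, |t k| ^ p ≤ J.card • δ ^ p :=
        Finset.sum_le_card_nsmul _ _ _ fun k hk =>
          Real.rpow_le_rpow (abs_nonneg _) (htδ k hk) hp.le
    _ ≤ η := by rwa [nsmul_eq_mul]

lemma exists_sum_smul_eq_zero_sum_rpow_le {a : ℕ → E} (ha : Bornology.IsBounded (Set.range a))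
    {p η : ℝ} (hp : 0 < p) (hη : 0 < η) :
    ∃ (s : Finset ℕ) (x : ℕ → ℝ), ∑ k ∈ s, x k • a k = 0 ∧ ∑ k ∈ s, |x k| ^ p ≤ 2 + η ∧
      2 ≤ ∑ k ∈ s, x k ^ 2 := by
  obtain ⟨J, i, j, t, hi, hj, hij, hsum, htη⟩ := exists_sub_eq_sum_smul_sum_rpow_le ha hp hη
  have hj' : j ∉ insert i J := by simp [hij.symm, hj]
  set x : ℕ → ℝ := fun k => if k = i then 1 else if k = j then -1 else t k
  have hxi : x i = 1 := if_pos rfl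
  have hxj : x j = -1 := (if_neg hij.symm).trans (if_pos rfl)
  have hxJ : ∀ k ∈ J, x k = t k := fun k hk =>
    (if_neg (ne_of_mem_of_not_mem hk hi)).trans (if_neg (ne_of_mem_of_not_mem hk hj))
  refine ⟨insert j (insert i J), x, ?_, ?_, ?_⟩ <;>
    rw [Finset.sum_insert hj', Finset.sum_insert hi, hxi, hxj]
  · rw [Finset.sum_congr rfl fun k hk => by rw [hxJ k hk], hsum]
    module
  · rw [Finset.sum_congr rfl fun k hk => by rw [hxJ k hk], abs_neg, abs_one, Real.one_rpow]
    linarith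
  · linarith [Finset.sum_nonneg fun k (_ : k ∈ J) => sq_nonneg (x k)]

end LinearRelations

/-! ### The `L²` norm of a linear function -/

section LinearFunctions

/-- The `k`-th coordinate function on `[-1,1]^ℕ`; linear functions are written as finite sums
`∑ k ∈ s, c k • coord k`. -/
noncomputable def coord (k : ℕ) : C(U, ℝ) := ⟨fun y => (y k : ℝ), by fun_prop⟩

lemma coord_apply (k : ℕ) (y : U) : coord k y = (y k : ℝ) := rfl

lemma norm_coord_le_one (k : ℕ) : ‖coord k‖ ≤ 1 :=
  (ContinuousMap.norm_le _ zero_le_one).mpr fun y => abs_le.mpr (y k).2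

instance : IsProbabilityMeasure rho :=
  inferInstanceAs (IsProbabilityMeasure (Measure.infinitePi fun _ : ℕ => unif))

lemma memLp_rho (f : C(U, ℝ)) (q : ℝ≥0∞) : MemLp f q rho :=
  f.continuous.memLp_of_hasCompactSupport (.of_compactSpace f)

lemma integral_unif (g : ℝ → ℝ) : ∫ x, g x ∂unif = (1 / 2) * ∫ x in (-1 : ℝ)..1, g x := by
  rw [unif, integral_smul_measure, integral_subtype_comap measurableSet_Icc g,
    integral_Icc_eq_integral_Ioc, ← intervalIntegral.integral_of_le (by norm_num)]
  simp

lemma variance_unif : Var[fun x : Set.Icc (-1 : ℝ) 1 => (x : ℝ); unif] = 1 / 3 := by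
  have hmean : ∫ x : Set.Icc (-1 : ℝ) 1, (x : ℝ) ∂unif = 0 := by
    rw [integral_unif fun x => x]
    norm_num
  rw [variance_of_integral_eq_zero (by fun_prop) hmean, integral_unif fun x => x ^ 2]
  norm_num

lemma variance_coord (k : ℕ) : Var[coord k; rho] = 1 / 3 := by
  have hmp : MeasurePreserving (Function.eval k) rho unif := measurePreserving_eval_infinitePi _ k
  rw [← variance_unif, ← hmp.map_eq, variance_map (by fun_prop) hmp.measurable.aemeasurable]
  rfl

lemma variance_sum_smul_coord (s : Finset ℕ) (c : ℕ → ℝ) :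
    Var[(∑ k ∈ s, c k • coord k : C(U, ℝ)); rho] = (∑ k ∈ s, c k ^ 2) / 3 := by
  have hindep : iIndepFun (fun k (y : U) => c k * (y k : ℝ)) rho :=
    iIndepFun_infinitePi (X := fun k (x : Set.Icc (-1 : ℝ) 1) => c k * (x : ℝ)) fun k => by fun_prop
  rw [ContinuousMap.coe_sum, IndepFun.variance_sum (fun k _ => memLp_rho _ 2)
    fun i _ j _ hij => hindep.indepFun hij, Finset.sum_div]
  refine Finset.sum_congr rfl fun k _ => ?_
  rw [ContinuousMap.coe_smul, variance_smul, variance_coord]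
  ring

lemma ofReal_sqrt_variance_le_eLpNorm {Ω : Type*} [MeasurableSpace Ω] {μ : Measure Ω}
    [IsProbabilityMeasure μ] {X : Ω → ℝ} (hX : MemLp X 2 μ) :
    ENNReal.ofReal √(Var[X; μ]) ≤ eLpNorm X 2 μ := by
  rw [hX.eLpNorm_eq_integral_rpow_norm two_ne_zero ENNReal.ofNat_ne_top, Real.sqrt_eq_rpow]
  simp only [ENNReal.toReal_ofNat, Real.rpow_ofNat, Real.norm_eq_abs, sq_abs, one_div]
  gcongr
  exacts [variance_nonneg _ _, variance_le_expectation_sq hX.1]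

lemma ofReal_sqrt_sum_sq_le_eLpNorm (s : Finset ℕ) (c : ℕ → ℝ) :
    ENNReal.ofReal √((∑ k ∈ s, c k ^ 2) / 3) ≤
      eLpNorm (∑ k ∈ s, c k • coord k : C(U, ℝ)) 2 rho := by
  rw [← variance_sum_smul_coord]
  exact ofReal_sqrt_variance_le_eLpNorm (memLp_rho _ 2)

end LinearFunctions

/-! ### Linear functions in the class `H b` -/

section HolomorphicClass

lemma monotoneOn_add_inv : MonotoneOn (fun t : ℝ => t + t⁻¹) (Set.Ici 1) := by
  intro s hs t ht hst
  have hs0 : 0 < s := zero_lt_one.trans_le hs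
  have ht0 : 0 < t := zero_lt_one.trans_le ht
  have hfactor : t + t⁻¹ - (s + s⁻¹) = (t - s) * (1 - s⁻¹ * t⁻¹) := by
    field_simp
    ring
  have hle : s⁻¹ * t⁻¹ ≤ 1 :=
    mul_le_one₀ (inv_le_one_of_one_le₀ hs) (by positivity) (inv_le_one_of_one_le₀ ht)
  exact sub_nonneg.mp (hfactor ▸ mul_nonneg (sub_nonneg.mpr hst) (sub_nonneg.mpr hle))

lemma one_le_add_inv_div_two {ρ : ℝ} (hρ : 1 ≤ ρ) : 1 ≤ (ρ + ρ⁻¹) / 2 := by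
  have h : (1 : ℝ) + 1⁻¹ ≤ ρ + ρ⁻¹ := monotoneOn_add_inv (Set.mem_Ici.mpr le_rfl) hρ hρ
  norm_num at h
  linarith

lemma norm_le_of_mem_bernsteinEllipse {ρ : ℝ} {w : ℂ} (hw : w ∈ bernsteinEllipse ρ) :
    ‖w‖ ≤ (ρ + ρ⁻¹) / 2 := by
  obtain ⟨z, hz1, hzρ, rfl⟩ := hw
  calc ‖(z + z⁻¹) / 2‖ = ‖z + z⁻¹‖ / 2 := by simp
    _ ≤ (‖z‖ + ‖z‖⁻¹) / 2 := by
      gcongr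
      exact (norm_add_le _ _).trans_eq (by rw [norm_inv])
    _ ≤ (ρ + ρ⁻¹) / 2 := by
      gcongr ?_ / 2
      exact monotoneOn_add_inv hz1 (hz1.trans hzρ) hzρ

variable {b c : ℕ → ℝ} {s : Finset ℕ}

lemma norm_sum_mul_le_one_of_mem_region (hb : ∀ j, 0 ≤ b j) (hs : ∑ k ∈ s, b k ≤ 1)
    (hc : ∀ k ∈ s, |c k| ≤ b k / 2) {z : ℕ → ℂ} (hz : z ∈ region b 1) :
    ‖∑ k ∈ s, (c k : ℂ) * z k‖ ≤ 1 := by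
  obtain ⟨ρ, hρ, hsum, hle, hz⟩ := hz
  have hpartial : ∑ k ∈ s, ((ρ k + (ρ k)⁻¹) / 2 - 1) * b k ≤ 1 :=
    (hsum.sum_le_tsum s fun k _ =>
      mul_nonneg (sub_nonneg.mpr (one_le_add_inv_div_two (hρ k))) (hb k)).trans hle
  calc ‖∑ k ∈ s, (c k : ℂ) * z k‖ ≤ ∑ k ∈ s, ‖(c k : ℂ) * z k‖ := norm_sum_le _ _
    _ ≤ ∑ k ∈ s, b k / 2 * ((ρ k + (ρ k)⁻¹) / 2) := by
      refine Finset.sum_le_sum fun k hk => ?_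
      rw [norm_mul, Complex.norm_real]
      exact mul_le_mul (hc k hk) (norm_le_of_mem_bernsteinEllipse (hz k)) (norm_nonneg _)
        (div_nonneg (hb k) zero_le_two)
    _ = (∑ k ∈ s, ((ρ k + (ρ k)⁻¹) / 2 - 1) * b k + ∑ k ∈ s, b k) / 2 := by
      rw [← Finset.sum_add_distrib, Finset.sum_div]
      exact Finset.sum_congr rfl fun k _ => by ring
    _ ≤ 1 := by linarith

lemma sum_smul_coord_mem_H (hb : ∀ j, 0 ≤ b j) (hs : ∑ k ∈ s, b k ≤ 1)
    (hc : ∀ k ∈ s, |c k| ≤ b k / 2) : ∑ k ∈ s, c k • coord k ∈ H b := by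
  refine ⟨fun z => ∑ k ∈ s, (c k : ℂ) * z k,
    ⟨⟨Set.univ, Set.subset_univ _, isOpen_univ, fun z _ j => ?_⟩, fun y => ?_⟩,
    fun z => norm_sum_mul_le_one_of_mem_region hb hs hc⟩
  · refine DifferentiableAt.fun_sum fun k _ => ?_
    simp only [Pi.add_apply, Pi.single_apply]
    split_ifs <;> fun_prop
  · simp [toComplex, coord_apply]

lemma neg_mem_H {f : C(U, ℝ)} (hf : f ∈ H b) : -f ∈ H b := by
  obtain ⟨F, ⟨⟨O, hO, hopen, hdiff⟩, hext⟩, hbound⟩ := hf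
  exact ⟨-F, ⟨⟨O, hO, hopen, fun z hz j => (hdiff z hz j).neg⟩, fun y => by simp [hext y]⟩,
    fun z hz => by simpa using hbound z hz⟩

lemma neg_mem_Hp {p : ℝ} {f : C(U, ℝ)} (hf : f ∈ Hp p) : -f ∈ Hp p := by
  obtain ⟨b, hb, hfb⟩ := Set.mem_iUnion₂.mp hf
  exact Set.mem_biUnion hb (neg_mem_H hfb)

end HolomorphicClass

/-! ### Lower bounds for adaptive widths -/

section Width

lemma width_mono (m : ℕ) {K K' : Set C(U, ℝ)} (h : K ⊆ K') : width m K ≤ width m K' :=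
  iInf_mono fun _ => iInf_mono fun _ => iInf_mono fun _ => biSup_mono h

lemma adaptiveSampling_eq_zero {m : ℕ} {T : C(U, ℝ) → (Fin m → ℝ)}
    {S : (i : Fin m) → (Fin i.val → ℝ) → (C(U, ℝ) →L[ℝ] ℝ)}
    (hT : ∀ (f : C(U, ℝ)) (i : Fin m),
      T f i = S i (fun j : Fin i.val => T f (Fin.castLE i.isLt.le j)) f)
    {f : C(U, ℝ)} (hf : ∀ i, S i 0 f = 0) : T f = 0 := by
  have hzero : ∀ (n : ℕ) (hn : n < m), T f ⟨n, hn⟩ = 0 := by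
    intro n
    induction n using Nat.strong_induction_on with
    | _ n ih =>
      intro hn
      have hprev : (fun j : Fin n => T f (Fin.castLE hn.le j)) = 0 :=
        funext fun j => ih j j.isLt _
      rw [hT]
      exact (congrArg (fun y => S ⟨n, hn⟩ y f) hprev).trans (hf _)
  exact funext fun i => hzero i i.isLt

lemma eLpNorm_le_max_eLpNorm_sub_eLpNorm_neg_sub {α F : Type*} [MeasurableSpace α]
    {μ : Measure α} [NormedAddCommGroup F] [NormedSpace ℝ F] {q : ℝ≥0∞} (hq : 1 ≤ q) {f g : α → F}
    (hf : AEStronglyMeasurable f μ) (hg : AEStronglyMeasurable g μ) :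
    eLpNorm f q μ ≤ max (eLpNorm (f - g) q μ) (eLpNorm (-f - g) q μ) := by
  set M := max (eLpNorm (f - g) q μ) (eLpNorm (-f - g) q μ)
  have hdouble : 2 * eLpNorm f q μ ≤ 2 * M :=
    calc 2 * eLpNorm f q μ = eLpNorm ((2 : ℝ) • f) q μ := by
          rw [eLpNorm_const_smul]
          simp [enorm_eq_nnnorm]
      _ = eLpNorm ((f - g) - (-f - g)) q μ := by
          congr 1
          module
      _ ≤ eLpNorm (f - g) q μ + eLpNorm (-f - g) q μ :=
          eLpNorm_sub_le (hf.sub hg) (hf.neg.sub hg) hq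
      _ ≤ M + M := add_le_add (le_max_left _ _) (le_max_right _ _)
      _ = 2 * M := (two_mul M).symm
  exact (ENNReal.mul_le_mul_iff_right two_ne_zero ENNReal.ofNat_ne_top).mp hdouble

variable {m : ℕ} {K : Set C(U, ℝ)}

lemma le_width_of_forall_exists_apply_eq_zero (hK : ∀ f ∈ K, -f ∈ K) {r : ℝ≥0∞}
    (h : ∀ Φ : Fin m → (C(U, ℝ) →L[ℝ] ℝ), ∃ f ∈ K, (∀ i, Φ i f = 0) ∧ r ≤ eLpNorm f 2 rho) :
    r ≤ width m K := by
  refine le_iInf fun T => le_iInf fun ⟨S, hT⟩ => le_iInf fun R => ?_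
  obtain ⟨f, hfK, hf, hr⟩ := h fun i => S i 0
  have hTf : T f = 0 := adaptiveSampling_eq_zero hT hf
  have hTneg : T (-f) = 0 := adaptiveSampling_eq_zero hT fun i => by simp [hf i]
  have hle : ∀ g ∈ K, T g = 0 → eLpNorm (⇑g - ⇑(R 0)) 2 rho ≤
      ⨆ f ∈ K, eLpNorm (fun y : U => f y - R (T f) y) 2 rho := fun g hg hTg => by
    rw [← hTg]
    exact le_biSup (fun f : C(U, ℝ) => eLpNorm (fun y : U => f y - R (T f) y) 2 rho) hg
  exact hr.trans <| (eLpNorm_le_max_eLpNorm_sub_eLpNorm_neg_sub one_le_two (memLp_rho f 2).1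
    (memLp_rho (R 0) 2).1).trans <| max_le (hle f hfK hTf) (hle (-f) (hK f hfK) hTneg)

lemma isBounded_range_apply_coord (Φ : Fin m → (C(U, ℝ) →L[ℝ] ℝ)) :
    Bornology.IsBounded (Set.range fun k i => Φ i (coord k)) := by
  refine isBounded_iff_forall_norm_le.mpr ⟨‖Φ‖, ?_⟩
  rintro _ ⟨k, rfl⟩
  refine (pi_norm_le_iff_of_nonneg (norm_nonneg _)).mpr fun i => ?_
  calc ‖Φ i (coord k)‖ ≤ ‖Φ i‖ * ‖coord k‖ := (Φ i).le_opNorm _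
    _ ≤ ‖Φ i‖ := mul_le_of_le_one_right (norm_nonneg (Φ i)) (norm_coord_le_one k)
    _ ≤ ‖Φ‖ := norm_le_pi_norm Φ i

lemma ofReal_sqrt_le_width_of_forall_exists_relation (hK : ∀ f ∈ K, -f ∈ K) {r : ℝ}
    (h : ∀ a : ℕ → Fin m → ℝ, Bornology.IsBounded (Set.range a) →
      ∃ (s : Finset ℕ) (c : ℕ → ℝ), ∑ k ∈ s, c k • a k = 0 ∧ ∑ k ∈ s, c k • coord k ∈ K ∧
        r ≤ ∑ k ∈ s, c k ^ 2) :
    ENNReal.ofReal √(r / 3) ≤ width m K := by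
  refine le_width_of_forall_exists_apply_eq_zero hK fun Φ => ?_
  obtain ⟨s, c, hrel, hmem, hr⟩ := h _ (isBounded_range_apply_coord Φ)
  refine ⟨_, hmem, fun i => ?_, le_trans (by gcongr) (ofReal_sqrt_sum_sq_le_eLpNorm s c)⟩
  simpa using congrFun hrel i

end Width

/-! ### Unit balls of sequences -/

lemma memℓp_and_lpNorm_le_one_iff {p : ℝ} (hp : 0 < p) {b : ℕ → ℝ} :
    Memℓp b (ENNReal.ofReal p) ∧ lpNorm p b ≤ 1 ↔ ∀ s : Finset ℕ, ∑ k ∈ s, |b k| ^ p ≤ 1 := by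
  have hnonneg : ∀ j, 0 ≤ |b j| ^ p := fun j => by positivity
  have hmem : Memℓp b (ENNReal.ofReal p) ↔ Summable fun j => |b j| ^ p := by
    have htoReal := ENNReal.toReal_ofReal hp.le
    rw [memℓp_gen_iff (by rwa [htoReal]), htoReal]
    rfl
  have hnorm : lpNorm p b ≤ 1 ↔ ∑' j, |b j| ^ p ≤ 1 := by
    rw [lpNorm, ← Real.rpow_le_rpow_iff (tsum_nonneg hnonneg) zero_le_one (one_div_pos.mpr hp),
      Real.one_rpow]
  rw [hmem, hnorm]
  exact ⟨fun ⟨hsum, hle⟩ s => (hsum.sum_le_tsum s fun k _ => hnonneg k).trans hle, fun h =>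
    ⟨summable_of_sum_le hnonneg h, Real.tsum_le_of_sum_le hnonneg h⟩⟩

lemma sum_rpow_le_one_of_forall_notMem_eq_zero {p : ℝ} (hp : 0 < p) {b : ℕ → ℝ} {t : Finset ℕ}
    (hb : ∀ k ∉ t, b k = 0) (h : ∑ k ∈ t, |b k| ^ p ≤ 1) (s : Finset ℕ) :
    ∑ k ∈ s, |b k| ^ p ≤ 1 := by
  have hout : ∀ k ∉ t, |b k| ^ p = 0 := fun k hk => by
    rw [hb k hk, abs_zero, Real.zero_rpow hp.ne']
  calc ∑ k ∈ s, |b k| ^ p ≤ ∑' k, |b k| ^ p :=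
        (summable_of_ne_finset_zero hout).sum_le_tsum s fun k _ => by positivity
    _ = ∑ k ∈ t, |b k| ^ p := tsum_eq_sum hout
    _ ≤ 1 := h

lemma unitBallM_subset_unitBall {p : ℝ} (hp : 0 < p) : unitBallM p ⊆ unitBall p := by
  rintro b ⟨hb, hbdd, hmaj⟩
  have hle : ∀ j, |b j| ≤ |majorant b j| := fun j =>
    (le_ciSup (f := fun k : {k : ℕ // j ≤ k} => |b k|)
      ((memℓp_infty_iff.mp hbdd).mono (Set.range_comp_subset_range Subtype.val fun k => ‖b k‖))
      ⟨j, le_rfl⟩).trans (le_abs_self _)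
  refine ⟨hb, (memℓp_and_lpNorm_le_one_iff hp).mpr fun s => ?_⟩
  exact (Finset.sum_le_sum fun k _ => Real.rpow_le_rpow (abs_nonneg _) (hle k) hp.le).trans
    ((memℓp_and_lpNorm_le_one_iff hp).mp hmaj s)

lemma sum_le_one_of_mem_unitBall {p : ℝ} (hp : 0 < p) (hp1 : p ≤ 1) {b : ℕ → ℝ}
    (hb : b ∈ unitBall p) (s : Finset ℕ) : ∑ k ∈ s, b k ≤ 1 := by
  obtain ⟨hb0, hbp⟩ := hb
  have hsum := (memℓp_and_lpNorm_le_one_iff hp).mp hbp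
  refine (Finset.sum_le_sum fun k _ => ?_).trans (hsum s)
  have hbk : |b k| ≤ 1 := by
    rw [← Real.rpow_le_rpow_iff (abs_nonneg _) zero_le_one hp, Real.one_rpow]
    simpa using hsum {k}
  rw [abs_of_nonneg (hb0 k)] at hbk ⊢
  exact Real.self_le_rpow_of_le_one (hb0 k) hbk hp1

lemma majorant_eq_self {b : ℕ → ℝ} (hb0 : ∀ j, 0 ≤ b j) (hb : Antitone b) : majorant b = b := by
  funext i
  have hgreatest : IsGreatest (Set.range fun k : {k : ℕ // i ≤ k} => |b k|) (b i) := by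
    refine ⟨⟨⟨i, le_rfl⟩, abs_of_nonneg (hb0 i)⟩, ?_⟩
    rintro _ ⟨k, rfl⟩
    exact (abs_of_nonneg (hb0 k)).trans_le (hb k.2)
  exact hgreatest.csSup_eq

lemma mem_unitBallM_of_antitone {p : ℝ} {b : ℕ → ℝ} (hb : b ∈ unitBall p) (hanti : Antitone b) :
    b ∈ unitBallM p := by
  obtain ⟨hb0, hmem, hle⟩ := hb
  refine ⟨hb0, hmem.of_exponent_ge le_top, ?_⟩
  rw [majorant_eq_self hb0 hanti]
  exact ⟨hmem, hle⟩

/-- The extremal sequence of the monotone unit ball: `n` leading entries `n ^ (-1 / p)`, which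
give it `ℓᵖ` norm one, followed by zeros. -/
noncomputable def blockSeq (p : ℝ) (n : ℕ) : ℕ → ℝ :=
  fun j => if j < n then (n : ℝ) ^ (-(1 / p)) else 0

lemma blockSeq_of_lt {p : ℝ} {n j : ℕ} (h : j < n) : blockSeq p n j = (n : ℝ) ^ (-(1 / p)) :=
  if_pos h

lemma blockSeq_of_le {p : ℝ} {n j : ℕ} (h : n ≤ j) : blockSeq p n j = 0 := if_neg h.not_gt

lemma blockSeq_nonneg (p : ℝ) (n j : ℕ) : 0 ≤ blockSeq p n j := by
  rw [blockSeq]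
  split_ifs <;> positivity

lemma blockSeq_antitone (p : ℝ) (n : ℕ) : Antitone (blockSeq p n) := by
  intro i j hij
  rcases lt_or_ge j n with hj | hj
  · rw [blockSeq_of_lt hj, blockSeq_of_lt (hij.trans_lt hj)]
  · rw [blockSeq_of_le hj]
    exact blockSeq_nonneg p n i

lemma blockSeq_mem_unitBallM {p : ℝ} (hp : 0 < p) (n : ℕ) : blockSeq p n ∈ unitBallM p := by
  have hpow : ∀ j ∈ Finset.range n, |blockSeq p n j| ^ p = (n : ℝ)⁻¹ := fun j hj => by
    rw [blockSeq_of_lt (Finset.mem_range.mp hj), abs_of_nonneg (by positivity),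
      ← Real.rpow_mul n.cast_nonneg, neg_mul, one_div_mul_cancel hp.ne', Real.rpow_neg_one]
  refine mem_unitBallM_of_antitone ⟨blockSeq_nonneg p n, (memℓp_and_lpNorm_le_one_iff hp).mpr <|
    sum_rpow_le_one_of_forall_notMem_eq_zero hp (t := Finset.range n)
      (fun k hk => blockSeq_of_le (by simpa using hk)) ?_⟩ (blockSeq_antitone p n)
  rw [Finset.sum_congr rfl hpow, Finset.sum_const, Finset.card_range, nsmul_eq_mul]
  exact mul_inv_le_one

/-! ### Known anisotropy -/

lemma thetaBarM_le_thetaBar (m : ℕ) {p : ℝ} (hp : 0 < p) : thetaBarM m p ≤ thetaBar m p :=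
  biSup_mono (unitBallM_subset_unitBall hp)

lemma thetaBarM_le_thetaM (m : ℕ) (p : ℝ) : thetaBarM m p ≤ thetaM m p :=
  iSup₂_le fun _ hb => width_mono m (Set.subset_biUnion_of_mem hb)

lemma ofReal_le_width_H (m : ℕ) {b : ℕ → ℝ} (hb : ∀ j, 0 ≤ b j) {s : Finset ℕ}
    (hs : ∑ k ∈ s, b k ≤ 1) {β : ℝ} (hβ : 0 ≤ β) (hβb : ∀ k ∈ s, β ≤ b k) :
    ENNReal.ofReal (β * √((s.card - m) / 12)) ≤ width m (H b) := by
  have hsqrt : β * √((s.card - m) / 12) = √((β / 2) ^ 2 * (s.card - m) / 3) := by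
    rw [show (β / 2) ^ 2 * (s.card - m) / 3 = β ^ 2 * ((s.card - m) / 12) by ring,
      Real.sqrt_mul (sq_nonneg β), Real.sqrt_sq hβ]
  rw [hsqrt]
  refine ofReal_sqrt_le_width_of_forall_exists_relation (fun _ => neg_mem_H) fun a _ => ?_
  obtain ⟨x, hrel, hx1, hx2⟩ := exists_sum_smul_eq_zero_card_sub_finrank_le a s
  rw [finrank_fin_fun] at hx2
  refine ⟨s, fun k => β / 2 * x k, ?_, sum_smul_coord_mem_H hb hs fun k hk => ?_, ?_⟩
  · simp only [mul_smul, ← Finset.smul_sum, hrel, smul_zero]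
  · calc |β / 2 * x k| = β / 2 * |x k| := by rw [abs_mul, abs_of_nonneg (by positivity)]
      _ ≤ β / 2 := mul_le_of_le_one_right (by positivity) (hx1 k hk)
      _ ≤ b k / 2 := by
          gcongr
          exact hβb k hk
  · simp only [mul_pow, ← Finset.mul_sum]
    gcongr

lemma ofReal_le_thetaBarM (m : ℕ) {p : ℝ} (hp : 0 < p) (hp1 : p ≤ 1) (n : ℕ) :
    ENNReal.ofReal ((n : ℝ) ^ (-(1 / p)) * √((n - m) / 12)) ≤ thetaBarM m p := by
  have hmem := blockSeq_mem_unitBallM hp n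
  have hwidth := ofReal_le_width_H m (blockSeq_nonneg p n) (s := Finset.range n)
    (sum_le_one_of_mem_unitBall hp hp1 (unitBallM_subset_unitBall hp hmem) _)
    (by positivity) fun k hk => (blockSeq_of_lt (Finset.mem_range.mp hk)).ge
  rw [Finset.card_range] at hwidth
  exact hwidth.trans (le_biSup (fun b => width m (H b)) hmem)

lemma ofReal_sqrt_mul_rpow_le_thetaBarM {m : ℕ} (hm : 1 ≤ m) {p : ℝ} (hp : 0 < p) (hp1 : p ≤ 1) :
    ENNReal.ofReal (√(1 / 12) * 2 ^ (-(1 / p)) * m ^ (1 / 2 - 1 / p)) ≤ thetaBarM m p := by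
  have hm0 : (0 : ℝ) < m := by exact_mod_cast hm
  refine (ENNReal.ofReal_le_ofReal (le_of_eq ?_)).trans (ofReal_le_thetaBarM m hp hp1 (2 * m))
  calc √(1 / 12) * 2 ^ (-(1 / p)) * (m : ℝ) ^ (1 / 2 - 1 / p)
      = (2 ^ (-(1 / p)) * (m : ℝ) ^ (-(1 / p))) * (√m * √(1 / 12)) := by
        rw [sub_eq_add_neg, Real.rpow_add hm0, ← Real.sqrt_eq_rpow]
        ring
    _ = ((2 * m : ℕ) : ℝ) ^ (-(1 / p)) * √(((2 * m : ℕ) - m) / 12) := by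
        rw [← Real.mul_rpow zero_le_two hm0.le, ← Real.sqrt_mul hm0.le]
        push_cast
        ring_nf

/-! ### Unknown anisotropy -/

lemma sum_smul_coord_mem_Hp {p : ℝ} (hp : 0 < p) (hp1 : p ≤ 1) {s : Finset ℕ} {c : ℕ → ℝ}
    (hc : ∑ k ∈ s, |2 * c k| ^ p ≤ 1) : ∑ k ∈ s, c k • coord k ∈ Hp p := by
  classical
  set b : ℕ → ℝ := fun k => if k ∈ s then |2 * c k| else 0
  have hbs : ∀ k ∈ s, b k = |2 * c k| := fun k hk => if_pos hk
  have hb0 : ∀ k, 0 ≤ b k := fun k => by positivity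
  have hb : b ∈ unitBall p := by
    refine ⟨hb0, (memℓp_and_lpNorm_le_one_iff hp).mpr <|
      sum_rpow_le_one_of_forall_notMem_eq_zero hp (fun k hk => if_neg hk) ?_⟩
    rwa [Finset.sum_congr rfl fun k hk => by rw [hbs k hk, abs_abs]]
  refine Set.mem_biUnion hb (sum_smul_coord_mem_H hb0 (sum_le_one_of_mem_unitBall hp hp1 hb s)
    fun k hk => ?_)
  rw [hbs k hk, abs_mul, abs_two, mul_div_cancel_left₀ _ two_ne_zero]

lemma ofReal_sqrt_mul_rpow_le_theta (m : ℕ) {p : ℝ} (hp : 0 < p) (hp1 : p ≤ 1) :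
    ENNReal.ofReal (√(1 / 12) * 2 ^ (1 / 2 - 2 / p)) ≤ theta m p := by
  set γ : ℝ := 2 ^ (-(2 / p))
  have hγ : 0 < γ := by positivity
  have hγp : γ ^ p = 1 / 4 := by
    rw [← Real.rpow_mul zero_le_two, neg_mul, div_mul_cancel₀ _ hp.ne', Real.rpow_neg zero_le_two]
    norm_num
  have hsqrt : √(1 / 12) * 2 ^ (1 / 2 - 2 / p) = √((γ / 2) ^ 2 * 2 / 3) := by
    calc √(1 / 12) * 2 ^ (1 / 2 - 2 / p) = γ * (√2 * √(1 / 12)) := by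
          rw [sub_eq_add_neg, Real.rpow_add zero_lt_two, ← Real.sqrt_eq_rpow]
          ring
      _ = √((γ / 2) ^ 2 * 2 / 3) := by
          rw [show (γ / 2) ^ 2 * 2 / 3 = γ ^ 2 * (2 * (1 / 12)) by ring,
            Real.sqrt_mul (sq_nonneg γ), Real.sqrt_sq hγ.le, Real.sqrt_mul zero_le_two]
  rw [hsqrt]
  refine ofReal_sqrt_le_width_of_forall_exists_relation (fun _ => neg_mem_Hp) fun a ha => ?_
  obtain ⟨s, x, hrel, hxp, hx2⟩ := exists_sum_smul_eq_zero_sum_rpow_le ha hp zero_lt_two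
  refine ⟨s, fun k => γ / 2 * x k, ?_, sum_smul_coord_mem_Hp hp hp1 ?_, ?_⟩
  · simp only [mul_smul, ← Finset.smul_sum, hrel, smul_zero]
  · calc ∑ k ∈ s, |2 * (γ / 2 * x k)| ^ p = ∑ k ∈ s, 1 / 4 * |x k| ^ p := by
          refine Finset.sum_congr rfl fun k _ => ?_
          rw [← mul_assoc, mul_div_cancel₀ _ two_ne_zero, abs_mul, abs_of_pos hγ,
            Real.mul_rpow hγ.le (abs_nonneg _), hγp]
      _ ≤ 1 := by
          rw [← Finset.mul_sum]
          linarith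
  · simp only [mul_pow, ← Finset.mul_sum]
    gcongr

end HolWidth

theorem theoremt_general {m : ℕ} {p : ℝ} (hm : 1 ≤ m) (hp : 0 < p) (hp1 : p ≤ 1) :
    HolWidth.thetaBarM m p ≤ HolWidth.thetaBar m p ∧
      HolWidth.thetaBarM m p ≤ HolWidth.thetaM m p ∧
      ENNReal.ofReal (√(1 / 12) * 2 ^ (-(1 / p)) * m ^ (1 / 2 - 1 / p))
        ≤ HolWidth.thetaBarM m p ∧
      ENNReal.ofReal (√(1 / 12) * 2 ^ (1 / 2 - 2 / p)) ≤ HolWidth.theta m p :=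
  ⟨HolWidth.thetaBarM_le_thetaBar m hp, HolWidth.thetaBarM_le_thetaM m p,
    HolWidth.ofReal_sqrt_mul_rpow_le_thetaBarM hm hp hp1,
    HolWidth.ofReal_sqrt_mul_rpow_le_theta m hp hp1⟩

theorem theoremt :
    ∃ c : ℝ, 0 < c ∧ ∀ (m : ℕ) (p : ℝ), 1 ≤ m → 0 < p → p < 1 →
      (HolWidth.thetaBarM m p ≤ HolWidth.thetaBar m p ∧
        ENNReal.ofReal (c * (2 : ℝ) ^ (-(1 / p)) * (m : ℝ) ^ (1 / 2 - 1 / p))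
          ≤ HolWidth.thetaBarM m p) ∧
      ENNReal.ofReal (c * (2 : ℝ) ^ (1 / 2 - 2 / p)) ≤ HolWidth.theta m p ∧
      (HolWidth.thetaBarM m p ≤ HolWidth.thetaM m p ∧
        ENNReal.ofReal (c * (2 : ℝ) ^ (-(1 / p)) * (m : ℝ) ^ (1 / 2 - 1 / p))
          ≤ HolWidth.thetaBarM m p) := by
  refine ⟨√(1 / 12), by positivity, fun m p hm hp hp1 => ?_⟩
  obtain ⟨hBar, hM, hBarM, htheta⟩ := theoremt_general hm hp hp1.le
  exact ⟨⟨hBar, hBarM⟩, htheta, hM, hBarM⟩
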